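/- **Setting.** There are $n$ mobile users and a finite set $\mathcal T$ of tasks. User $i$ has a private type $\theta_i=(c_i,\mathcal T_i)$: its cost $c_i\in[\underline c,\bar c]$ per task, where $0\le\underline c<\bar c$, and the set $\mathcal T_i\subseteq\mathcal T$ of tasks it can perform; put $k_i=|\mathcal T_i|$. The types of different users are independent. Given $\mathcal T_i$, the cost $c_i$ has a density $f_i(\cdot\mid k_i)$ on $[\underline c,\bar c]$, positive on $(\underline c,\bar c)$, with distribution function $F_i(\cdot\mid k_i)$. Each assigned task is completed with probability $\alpha\in(0,1)$, and each task has to be completed with probability at least $\beta\in[0,1)$. An auction maps bids $b_i=(\hat c_i,\hat{\mathcal T}_i)$, where $\hat c_i\in[\underline c,\bar c]$ and $\hat{\mathcal T}_i\subseteq\mathcal T_i$, to assigned task sets $\mathcal{AT}_i(b)$ and payments $p_i(b)$ (measurable, with finite expectations). With $n_i=|\mathcal{AT}_i|$, the utility of user $i$ is $u_i(b;\theta_i)=p_i(b)-c_i\,n_i(b)$, and $U_i(b_i;\theta_i)$ is its expectation over the truthful bids of the other users. The auction is * *BIC* if $U_i(\theta_i;\theta_i)\ge U_i(b_i;\theta_i)$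 for all users $i$, all types $\theta_i$ and all bids $b_i$ of that type; * *IR* if $U_i(\theta_i;\theta_i)\ge 0$ for all $i$ and $\theta_i$; * *feasible* if, whenever the request can be served with the reported task sets, every task is assigned to at least $\frac{\log(1-\beta)}{\log(1-\alpha)}$ users and $\mathcal{AT}_i\subseteq\hat{\mathcal T}_i$ for all $i$. It is *optimal* if it is BIC, IR and feasible and minimizes $\mathbb E\sum_i p_i$ (under truthful bids) among all such auctions. **CSOPT.** Let $r=\left\lceil\frac{\log(1-\beta)}{\log(1-\alpha)}\right\rceil$ and make $r$ copies of each task. Go through the users by increasing reported cost (ties broken by index) and give each user one copy of every reported task of which a copy is left. The payment of user $i$ is $p_i=n_i\hat c_i+V_{-i}-V$, where $V$ is the total reported cost of this greedy assignment and $V_{-i}$ that of the greedy assignment computed without user $i$. **Theorem.** Assume that 1. (regularity) $H_i(c,k)=c+\frac{F_i(c\mid k)}{f_i(c\mid k)}$ is non-decreasing in $c$ and non-increasing in $k$, for every $i$; 2. (identically distributed costs) the cost distribution $F_i(\cdot\mid k)$ is the same for all users $i$ and all numbers of tasks $k$; 3. (enough competition) for all possible task sets $(\mathcal T_1,\dots,\mathcal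 T_n)$ and every user $i$, the request can be served without user $i$. Then CSOPT is an optimal auction. Moreover it is individually rational ex post: $u_i(\theta_i,b_{-i};\theta_i)\ge 0$ for all $i$, all $\theta_i$ and all bids $b_{-i}$ of the others with which the request can be served without user $i$. -/

import Mathlib

open MeasureTheory

/-- A type (or a bid) of a mobile user: its cost per task, and the set of tasks it can perform. -/
abbrev UserType (τ : Type*) := ℝ × Finset τ

/-- A crowdsensing instance with `n` mobile users and task set `τ`.
* `α` is the probability that a user completes an assigned task, `β` the required probability
  that a task is completed;
* costs per task lie in `[cLo, cHi]`;
* `taskLaw i` is the law of the task set `T` of user `i`;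
* `f i k` is the density of the cost of user `i`, given that it can perform `k = |T|` tasks.
Only the values `k` that user `i` attains with positive probability matter. -/
structure Crowdsensing (n : ℕ) (τ : Type*) [Fintype τ] [DecidableEq τ] where
  α : ℝ
  β : ℝ
  α_pos : 0 < α
  α_lt_one : α < 1
  β_nonneg : 0 ≤ β
  β_lt_one : β < 1
  cLo : ℝ
  cHi : ℝ
  cLo_nonneg : 0 ≤ cLo
  cLo_lt_cHi : cLo < cHi
  taskLaw : Fin n → PMF (Finset τ)
  f : Fin n → ℕ → ℝ → ℝ
  f_measurable : ∀ i, ∀ S ∈ (taskLaw i).support, Measurable (f i S.card)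
  f_nonneg : ∀ i, ∀ S ∈ (taskLaw i).support, ∀ c ∈ Set.Icc cLo cHi, 0 ≤ f i S.card c
  f_pos : ∀ i, ∀ S ∈ (taskLaw i).support, ∀ c ∈ Set.Ioo cLo cHi, 0 < f i S.card c
  f_integral : ∀ i, ∀ S ∈ (taskLaw i).support, ∫ c in cLo..cHi, f i S.card c = 1

/-- A direct mechanism: it maps bid profiles to assignments (user `i` gets the task set
`alloc b i`) and payments. -/
structure Auction (n : ℕ) (τ : Type*) where
  alloc : (Fin n → UserType τ) → Fin n → Finset τ
  pay : (Fin n → UserType τ) → Fin n → ℝ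

/-- The utility of user `i` with true cost `c` per task, when the bid profile is `b`. -/
def Auction.utility {n : ℕ} {τ : Type*} (M : Auction n τ) (i : Fin n)
    (b : Fin n → UserType τ) (c : ℝ) : ℝ :=
  M.pay b i - ((M.alloc b i).card : ℝ) * c

namespace Crowdsensing

variable {n : ℕ} {τ : Type*} [Fintype τ] [DecidableEq τ]

/-! ### The distribution of types -/

/-- The law of the cost of user `i`, given that it can perform `k` tasks. -/
noncomputable def costLaw (E : Crowdsensing n τ) (i : Fin n) (k : ℕ) : Measure ℝ :=
  (volume.restrict (Set.Icc E.cLo E.cHi)).withDensity fun c => ENNReal.ofReal (E.f i k c)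

/-- The law of the type `(c, T)` of user `i`: `T` is drawn from `taskLaw i`, then `c` from the
conditional law given `|T|`. -/
noncomputable def userLaw (E : Crowdsensing n τ) (i : Fin n) : Measure (UserType τ) :=
  ∑ S : Finset τ, (E.taskLaw i S) • (E.costLaw i S.card).map fun c => (c, S)

/-- The law of the type profile: types of different users are independent. -/
noncomputable def typeLaw (E : Crowdsensing n τ) : Measure (Fin n → UserType τ) :=
  Measure.pi E.userLaw

/-- The possible types of user `i`. -/
def types (E : Crowdsensing n τ) (i : Fin n) : Set (UserType τ) :=
  {θ | θ.1 ∈ Set.Icc E.cLo E.cHi ∧ θ.2 ∈ (E.taskLaw i).support}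

/-- The bids that a user of type `θ` can submit: any cost in the range, and any set of tasks that
it can perform. -/
def bids (E : Crowdsensing n τ) (θ : UserType τ) : Set (UserType τ) :=
  {b | b.1 ∈ Set.Icc E.cLo E.cHi ∧ b.2 ⊆ θ.2}

/-- The conditional distribution function `F_i(c | k)`. -/
noncomputable def F (E : Crowdsensing n τ) (i : Fin n) (k : ℕ) (c : ℝ) : ℝ :=
  ∫ z in E.cLo..c, E.f i k z

/-- The virtual cost `H_i(c, k) = c + F_i(c | k) / f_i(c | k)`. -/
noncomputable def virtualCost (E : Crowdsensing n τ) (i : Fin n) (c : ℝ) (k : ℕ) : ℝ :=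
  c + E.F i k c / E.f i k c

/-- Regularity: the virtual cost is non-decreasing in the cost and non-increasing in the number of
tasks. The endpoints of the cost range, where a density may vanish, are left out. -/
def Regular (E : Crowdsensing n τ) : Prop :=
  ∀ i, (∀ S ∈ (E.taskLaw i).support,
      MonotoneOn (fun c => E.virtualCost i c S.card) (Set.Ioo E.cLo E.cHi)) ∧
    (∀ S ∈ (E.taskLaw i).support, ∀ S' ∈ (E.taskLaw i).support, S.card ≤ S'.card →
      ∀ c ∈ Set.Ioo E.cLo E.cHi, E.virtualCost i c S'.card ≤ E.virtualCost i c S.card)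

/-- Costs are identically distributed: the conditional cost density is the same for all users and
all numbers of tasks that they can perform. -/
def IdenticalCosts (E : Crowdsensing n τ) : Prop :=
  ∀ i i', ∀ S ∈ (E.taskLaw i).support, ∀ S' ∈ (E.taskLaw i').support,
    ∀ c ∈ Set.Icc E.cLo E.cHi, E.f i S.card c = E.f i' S'.card c

/-! ### Feasibility -/

/-- The number of users that each task needs at least (a real number):
`1 - (1 - α) ^ m ≥ β` if and only if `m ≥ requirement`. -/
noncomputable def requirement (E : Crowdsensing n τ) : ℝ :=
  Real.log (1 - E.β) / Real.log (1 - E.α)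

/-- The repeat factor `r`: the least admissible number of users per task. -/
noncomputable def repeatFactor (E : Crowdsensing n τ) : ℕ := ⌈E.requirement⌉₊

/-- The users in `s` can serve the request, when `T i` is the task set of user `i`. -/
def Servable (E : Crowdsensing n τ) (s : Finset (Fin n)) (T : Fin n → Finset τ) : Prop :=
  ∀ j, E.requirement ≤ ((s.filter fun i => j ∈ T i).card : ℝ)

/-- Enough competition: for all possible task sets, the request can be served without any single
user. -/
def Competition (E : Crowdsensing n τ) : Prop :=
  ∀ T : Fin n → Finset τ, (∀ i, T i ∈ (E.taskLaw i).support) →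
    ∀ i, E.Servable (Finset.univ.erase i) T

/-- Feasibility: whenever the request can be served with the reported task sets, each task is
assigned to sufficiently many users, and each user only gets tasks that it reported. -/
def Feasible (E : Crowdsensing n τ) (M : Auction n τ) : Prop :=
  ∀ b : Fin n → UserType τ, (∀ i, (b i).1 ∈ Set.Icc E.cLo E.cHi) →
    E.Servable Finset.univ (fun i => (b i).2) →
    (∀ j, E.requirement ≤ ((Finset.univ.filter fun i => j ∈ M.alloc b i).card : ℝ)) ∧
      ∀ i, M.alloc b i ⊆ (b i).2

/-! ### Incentives and optimality -/

/-- Measurability and existence of the expectations that the definitions below refer to. -/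
def HasExpectations (E : Crowdsensing n τ) (M : Auction n τ) : Prop :=
  ∀ i, Measurable (fun b => M.alloc b i) ∧ Measurable (fun b => M.pay b i) ∧
    Integrable (fun θ => M.pay θ i) E.typeLaw ∧
    ∀ θ ∈ E.types i, ∀ bi ∈ E.bids θ,
      Integrable (fun θ' => M.pay (Function.update θ' i bi) i) E.typeLaw

/-- `U_i(bi; θ)`: the expected utility of user `i` with true cost `c` who bids `bi`, over the
truthful bids of the others. -/
noncomputable def interimUtility (E : Crowdsensing n τ) (M : Auction n τ) (i : Fin n)
    (bi : UserType τ) (c : ℝ) : ℝ :=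
  ∫ θ', M.utility i (Function.update θ' i bi) c ∂E.typeLaw

/-- Bayesian incentive compatibility. -/
def BIC (E : Crowdsensing n τ) (M : Auction n τ) : Prop :=
  ∀ i, ∀ θ ∈ E.types i, ∀ bi ∈ E.bids θ,
    E.interimUtility M i bi θ.1 ≤ E.interimUtility M i θ θ.1

/-- (Interim) individual rationality. -/
def IR (E : Crowdsensing n τ) (M : Auction n τ) : Prop :=
  ∀ i, ∀ θ ∈ E.types i, 0 ≤ E.interimUtility M i θ θ.1

/-- Ex post individual rationality: a truthful user never has negative utility, whatever the
others bid, provided that the request can be served without this user. -/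
def ExPostIR (E : Crowdsensing n τ) (M : Auction n τ) : Prop :=
  ∀ i, ∀ b : Fin n → UserType τ, (∀ i', (b i').1 ∈ Set.Icc E.cLo E.cHi) →
    E.Servable (Finset.univ.erase i) (fun i' => (b i').2) → 0 ≤ M.utility i b (b i).1

/-- The expected total payment of the crowdsensing provider under truthful bids. -/
noncomputable def expectedPayment (E : Crowdsensing n τ) (M : Auction n τ) : ℝ :=
  ∫ θ, ∑ i, M.pay θ i ∂E.typeLaw

/-- The constraints of the provider's problem. -/
def Admissible (E : Crowdsensing n τ) (M : Auction n τ) : Prop :=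
  E.HasExpectations M ∧ E.BIC M ∧ E.IR M ∧ E.Feasible M

/-- An optimal auction minimizes the expected total payment among the auctions that are BIC, IR and
feasible. -/
def IsOptimalAuction (E : Crowdsensing n τ) (M : Auction n τ) : Prop :=
  E.Admissible M ∧ ∀ M' : Auction n τ, E.Admissible M' → E.expectedPayment M ≤ E.expectedPayment M'

end Crowdsensing

/-! ### The mechanism CSOPT -/

namespace CSOPT

variable {n : ℕ} {τ : Type*} [Fintype τ] [DecidableEq τ]

/-- The greedy loop. The users in the list are served in that order; `rem` is the multiset of the
remaining copies of tasks. A user gets one copy of each remaining task that it reported. -/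
def greedy (T : Fin n → Finset τ) : List (Fin n) → Multiset τ → Fin n → Finset τ
  | [], _ => fun _ => ∅
  | i :: l, rem =>
      Function.update (greedy T l (rem - ((T i).filter fun j => j ∈ rem).val)) i
        ((T i).filter fun j => j ∈ rem)

open Classical in
/-- The users in `s`, sorted by reported cost (ties are broken by the index). -/
noncomputable def order (s : Finset (Fin n)) (b : Fin n → UserType τ) : List (Fin n) :=
  (s.sort (· ≤ ·)).insertionSort fun i i' => (b i).1 ≤ (b i').1

/-- ALLOC-RULE for the users in `s`, with `r` copies of each task. -/
noncomputable def allocRule (r : ℕ) (s : Finset (Fin n)) (b : Fin n → UserType τ) :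
    Fin n → Finset τ :=
  greedy (fun i => (b i).2) (order s b) (r • (Finset.univ : Finset τ).val)

/-- COST: the total reported cost of an assignment. -/
def cost (b : Fin n → UserType τ) (A : Fin n → Finset τ) : ℝ :=
  ∑ i, ((A i).card : ℝ) * (b i).1

/-- PAYMENT-RULE: `n_i c_i + (cost of the allocation without i) - (cost of the allocation)`. -/
noncomputable def payRule (r : ℕ) (b : Fin n → UserType τ) (i : Fin n) : ℝ :=
  ((allocRule r Finset.univ b i).card : ℝ) * (b i).1 +
    cost b (allocRule r (Finset.univ.erase i) b) - cost b (allocRule r Finset.univ b)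

/-- The auction CSOPT with repeat factor `r`. -/
noncomputable def auction (n : ℕ) (τ : Type*) [Fintype τ] [DecidableEq τ] (r : ℕ) : Auction n τ where
  alloc := allocRule r Finset.univ
  pay := payRule r

end CSOPT

/-! The proof is Myerson's revenue argument combined with the exchange property of greedy
assignment. Fix a user and its task set `S`. Incentive compatibility among the bids `(c, S)` alone
says that the truthful interim utility, as a function of `c`, has subgradient `-Q`, where `Q` is the
expected number of assigned tasks. It is therefore determined by `Q` and its value at `cHi`
(`eq_add_integral_of_subgradient`). Averaging over `c` and applying Fubini turns the information
rent into the `F / f` term of the virtual cost (`integral_payment_of_incentive_compatible`). So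
every BIC auction pays in expectation its expected virtual cost plus the rents at `cHi`
(`expectedPayment_eq`). IR makes these rents nonnegative, so it suffices that CSOPT minimizes
virtual cost profile by profile and leaves no rent at `cHi`. The assignment problem decouples over
tasks, and for each task the greedy rule takes the `r` cheapest eligible users. It thus minimizes
every nonnegative weight that is monotone in the reported cost (`sum_allocRule_le`). This is used
twice. With the cost itself as weight, the payments are Vickrey-Clarke-Groves payments, so
truthfulness is dominant and ex post rational. With the virtual cost as weight, which identical
distributions and regularity make a single monotone function of cost, it gives optimality. The rent
at `cHi` is zero because competition supplies a substitute that is no more expensive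
(`utility_auction_nonpos`). -/

set_option linter.unusedSectionVars false

/-! ### The greedy assignment, one task at a time -/

namespace CSOPT

variable {n : ℕ} {τ : Type*} [Fintype τ] [DecidableEq τ]

/-- The users to whom the assignment `A` gives the task `j`. -/
def servedBy (A : Fin n → Finset τ) (j : τ) : Finset (Fin n) :=
  Finset.univ.filter fun i => j ∈ A i

@[simp] lemma mem_servedBy {A : Fin n → Finset τ} {j : τ} {i : Fin n} :
    i ∈ servedBy A j ↔ j ∈ A i := by
  simp [servedBy]

/-- Double counting of the pairs (user, assigned task); this decouples the total weight into one
problem per task. -/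
lemma sum_card_mul (A : Fin n → Finset τ) (w : Fin n → ℝ) :
    ∑ i, ((A i).card : ℝ) * w i = ∑ j, ∑ i ∈ servedBy A j, w i := by
  simp only [servedBy, Finset.sum_filter]
  rw [Finset.sum_comm]
  refine Finset.sum_congr rfl fun i _ => ?_
  rw [← Finset.sum_filter, Finset.sum_const, nsmul_eq_mul]
  simp

lemma greedy_of_notMem (T : Fin n → Finset τ) {i : Fin n} {l : List (Fin n)} (hi : i ∉ l)
    (rem : Multiset τ) : greedy T l rem i = ∅ := by
  induction l generalizing rem with
  | nil => rfl
  | cons a l ih =>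
    rw [List.mem_cons, not_or] at hi
    rw [greedy, Function.update_of_ne hi.1, ih hi.2]

lemma greedy_subset (T : Fin n → Finset τ) (l : List (Fin n)) (rem : Multiset τ) (i : Fin n) :
    greedy T l rem i ⊆ T i := by
  induction l generalizing rem with
  | nil => simp [greedy]
  | cons a l ih =>
    rw [greedy]
    by_cases h : i = a
    · subst h
      simp
    · rw [Function.update_of_ne h]
      exact ih _

/-- For a fixed task `j` only the number of remaining copies of `j` matters. Hiding the rest of the
multiset behind `rem'` lets later inductions look at a single task. -/
lemma servedBy_greedy_cons (T : Fin n → Finset τ) {a : Fin n} {l : List (Fin n)} (ha : a ∉ l)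
    (rem : Multiset τ) (j : τ) :
    ∃ rem' : Multiset τ, if j ∈ T a ∧ j ∈ rem
      then rem'.count j + 1 = rem.count j ∧
        servedBy (greedy T (a :: l) rem) j = insert a (servedBy (greedy T l rem') j)
      else rem'.count j = rem.count j ∧
        servedBy (greedy T (a :: l) rem) j = servedBy (greedy T l rem') j := by
  refine ⟨rem - ((T a).filter fun j => j ∈ rem).val, ?_⟩
  have hcount : (((T a).filter fun j => j ∈ rem).val).count j =
      if j ∈ T a ∧ j ∈ rem then 1 else 0 := by
    rw [Multiset.count_eq_of_nodup (Finset.nodup _)]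
    simp
  split_ifs with h
  · refine ⟨?_, ?_⟩
    · have := Multiset.count_pos.2 h.2
      rw [Multiset.count_sub, hcount, if_pos h]
      omega
    · ext i
      by_cases hi : i = a
      · subst hi
        simp [greedy, h]
      · simp [greedy, hi]
  · refine ⟨?_, ?_⟩
    · rw [Multiset.count_sub, hcount, if_neg h, Nat.sub_zero]
    · ext i
      by_cases hi : i = a
      · subst hi
        simp [greedy, h, greedy_of_notMem T ha]
      · simp [greedy, hi]

lemma notMem_servedBy_greedy (T : Fin n → Finset τ) {a : Fin n} {l : List (Fin n)} (ha : a ∉ l)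
    (rem : Multiset τ) (j : τ) : a ∉ servedBy (greedy T l rem) j := by
  simp [greedy_of_notMem T ha]

lemma card_servedBy_greedy (T : Fin n → Finset τ) {l : List (Fin n)} (hl : l.Nodup)
    (rem : Multiset τ) (j : τ) :
    (servedBy (greedy T l rem) j).card =
      min (rem.count j) (l.toFinset.filter fun i => j ∈ T i).card := by
  induction l generalizing rem with
  | nil => simp [greedy, servedBy]
  | cons a l ih =>
    rw [List.nodup_cons] at hl
    obtain ⟨rem', h⟩ := servedBy_greedy_cons T hl.1 rem j
    have hfilter : ((a :: l).toFinset.filter fun i => j ∈ T i).card =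
        (l.toFinset.filter fun i => j ∈ T i).card + if j ∈ T a then 1 else 0 := by
      rw [List.toFinset_cons, Finset.filter_insert]
      split_ifs with hj
      · rw [Finset.card_insert_of_notMem (by simp [hl.1])]
      · simp
    rw [hfilter]
    split_ifs at h with hj
    · rw [h.2, Finset.card_insert_of_notMem (notMem_servedBy_greedy T hl.1 _ _), ih hl.2,
        if_pos hj.1]
      omega
    · rw [h.2, ih hl.2, h.1]
      by_cases hja : j ∈ T a
      · have : rem.count j = 0 := Multiset.count_eq_zero.2 fun h' => hj ⟨hja, h'⟩
        simp [this]
      · simp [hja]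

/-- Exchange argument: each user served by the greedy loop is matched with a distinct member of the
rival set `B` that weighs at least as much. -/
lemma sum_servedBy_greedy_le (T : Fin n → Finset τ) (w : Fin n → ℝ) (hw : ∀ i, 0 ≤ w i)
    {l : List (Fin n)} (hl : l.Nodup) (hsort : l.Pairwise fun i i' => w i ≤ w i')
    (rem : Multiset τ) (j : τ) (B : Finset (Fin n)) (hB : ∀ i ∈ B, i ∈ l ∧ j ∈ T i)
    (hcard : rem.count j ≤ B.card) :
    ∑ i ∈ servedBy (greedy T l rem) j, w i ≤ ∑ i ∈ B, w i := by
  induction l generalizing rem B with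
  | nil => simpa [greedy, servedBy] using Finset.sum_nonneg fun i _ => hw i
  | cons a l ih =>
    rw [List.nodup_cons] at hl
    rw [List.pairwise_cons] at hsort
    obtain ⟨rem', h⟩ := servedBy_greedy_cons T hl.1 rem j
    split_ifs at h with hj
    -- Pair `a` with itself if it lies in `B`, otherwise with any member of `B`, which comes later
    -- in the sorted list. Either way `B.erase x` avoids `a`, so the induction hypothesis applies.
    · obtain ⟨x, hxB, hx, hle⟩ : ∃ x ∈ B, (a ∈ B → x = a) ∧ w a ≤ w x := by
        by_cases haB : a ∈ B
        · exact ⟨a, haB, fun _ => rfl, le_rfl⟩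
        · have hpos : 0 < B.card := by omega
          obtain ⟨x, hx⟩ := Finset.card_pos.1 hpos
          refine ⟨x, hx, fun h => absurd h haB, hsort.1 x ?_⟩
          rcases List.mem_cons.1 (hB x hx).1 with rfl | h
          · exact absurd hx haB
          · exact h
      rw [h.2, Finset.sum_insert (notMem_servedBy_greedy T hl.1 _ _), ← Finset.add_sum_erase _ _ hxB]
      refine add_le_add hle (ih hl.2 hsort.2 rem' _ (fun i hi => ?_) ?_)
      · rw [Finset.mem_erase] at hi
        refine ⟨?_, (hB i hi.2).2⟩
        rcases List.mem_cons.1 (hB i hi.2).1 with rfl | h'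
        · exact absurd (hx hi.2).symm hi.1
        · exact h'
      · rw [Finset.card_erase_of_mem hxB]
        omega
    · rw [h.2]
      refine (ih hl.2 hsort.2 rem' (B.erase a) (fun i hi => ?_) ?_).trans
        (Finset.sum_le_sum_of_subset_of_nonneg (Finset.erase_subset _ _) fun i _ _ => hw i)
      · rw [Finset.mem_erase] at hi
        exact ⟨(List.mem_cons.1 (hB i hi.2).1).resolve_left hi.1, (hB i hi.2).2⟩
      -- If `a ∈ B` was not served, no copy of `j` is left and the cardinality bound is trivial.
      · rw [h.1]
        by_cases haB : a ∈ B
        · have : rem.count j = 0 := Multiset.count_eq_zero.2 fun h' => hj ⟨(hB a haB).2, h'⟩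
          omega
        · rwa [Finset.erase_eq_of_notMem haB]

lemma mem_order {s : Finset (Fin n)} {b : Fin n → UserType τ} {i : Fin n} :
    i ∈ order s b ↔ i ∈ s := by
  simp [order]

lemma nodup_order (s : Finset (Fin n)) (b : Fin n → UserType τ) : (order s b).Nodup :=
  (List.perm_insertionSort _ _).nodup_iff.2 (Finset.sort_nodup _ _)

lemma pairwise_order (s : Finset (Fin n)) (b : Fin n → UserType τ) :
    (order s b).Pairwise fun i i' => (b i).1 ≤ (b i').1 := by
  classical
  have : Std.Total fun i i' : Fin n => (b i).1 ≤ (b i').1 := ⟨fun i i' => le_total _ _⟩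
  have : IsTrans (Fin n) fun i i' : Fin n => (b i).1 ≤ (b i').1 := ⟨fun _ _ _ => le_trans⟩
  exact List.pairwise_insertionSort _ _

lemma allocRule_subset (r : ℕ) (s : Finset (Fin n)) (b : Fin n → UserType τ) (i : Fin n) :
    allocRule r s b i ⊆ (b i).2 :=
  greedy_subset _ _ _ i

lemma allocRule_eq_empty (r : ℕ) {s : Finset (Fin n)} (b : Fin n → UserType τ) {i : Fin n}
    (hi : i ∉ s) : allocRule r s b i = ∅ :=
  greedy_of_notMem _ (by rwa [mem_order]) _

lemma count_copies (r : ℕ) (j : τ) : (r • (Finset.univ : Finset τ).val).count j = r := by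
  rw [Multiset.count_nsmul, Multiset.count_eq_of_nodup (Finset.nodup _)]
  simp

lemma card_servedBy_allocRule {r : ℕ} {s : Finset (Fin n)} {b : Fin n → UserType τ} {j : τ}
    (h : r ≤ (s.filter fun i => j ∈ (b i).2).card) :
    (servedBy (allocRule r s b) j).card = r := by
  have : (order s b).toFinset = s := by
    ext i
    simp [mem_order]
  rw [allocRule, card_servedBy_greedy _ (nodup_order s b), count_copies, this]
  exact min_eq_left h

lemma sum_servedBy_allocRule_le {r : ℕ} {s : Finset (Fin n)} {b : Fin n → UserType τ}
    {w : Fin n → ℝ} (hw : ∀ i, 0 ≤ w i) (hmono : ∀ i i', (b i).1 ≤ (b i').1 → w i ≤ w i') {j : τ}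
    {B : Finset (Fin n)} (hB : ∀ i ∈ B, i ∈ s ∧ j ∈ (b i).2) (hcard : r ≤ B.card) :
    ∑ i ∈ servedBy (allocRule r s b) j, w i ≤ ∑ i ∈ B, w i := by
  refine sum_servedBy_greedy_le _ w hw (nodup_order s b)
    ((pairwise_order s b).imp fun {i i'} => hmono i i') _ j B (fun i hi => ?_) ?_
  · rw [mem_order]
    exact hB i hi
  · rwa [count_copies]

/-- The greedy assignment minimizes the total weight, for every nonnegative weight that is monotone
in the reported cost. -/
lemma sum_allocRule_le {r : ℕ} {s : Finset (Fin n)} {b : Fin n → UserType τ}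
    {w : Fin n → ℝ} (hw : ∀ i, 0 ≤ w i) (hmono : ∀ i i', (b i).1 ≤ (b i').1 → w i ≤ w i')
    {A : Fin n → Finset τ} (hA : ∀ i, A i ⊆ (b i).2) (hs : ∀ i ∉ s, A i = ∅)
    (hcard : ∀ j, r ≤ (servedBy A j).card) :
    ∑ i, ((allocRule r s b i).card : ℝ) * w i ≤ ∑ i, ((A i).card : ℝ) * w i := by
  rw [sum_card_mul, sum_card_mul]
  refine Finset.sum_le_sum fun j _ => sum_servedBy_allocRule_le hw hmono (fun i hi => ?_) (hcard j)
  rw [mem_servedBy] at hi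
  refine ⟨?_, hA i hi⟩
  by_contra his
  simp [hs i his] at hi

lemma cost_allocRule_le {r : ℕ} {s : Finset (Fin n)} {b : Fin n → UserType τ}
    (hb : ∀ i, 0 ≤ (b i).1)
    {A : Fin n → Finset τ} (hA : ∀ i, A i ⊆ (b i).2) (hs : ∀ i ∉ s, A i = ∅)
    (hcard : ∀ j, r ≤ (servedBy A j).card) : cost b (allocRule r s b) ≤ cost b A :=
  sum_allocRule_le hb (fun _ _ h => h) hA hs hcard

/-! ### Incentives under the Vickrey-Clarke-Groves payments -/

/-- The utility of a user is the cost of serving the others' assignment without it, minus the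
total true cost of the actual assignment. -/
lemma utility_auction_update (r : ℕ) (i : Fin n) (b : Fin n → UserType τ) (bi : UserType τ) :
    (auction n τ r).utility i (Function.update b i bi) (b i).1 =
      cost (Function.update b i bi)
          (allocRule r (Finset.univ.erase i) (Function.update b i bi)) -
        cost b (allocRule r Finset.univ (Function.update b i bi)) := by
  have h1 : ∀ A : Fin n → Finset τ, cost (Function.update b i bi) A =
      cost b A + ((A i).card : ℝ) * (bi.1 - (b i).1) := by
    intro A
    unfold cost
    rw [← Finset.add_sum_erase _ _ (Finset.mem_univ i),
      ← Finset.add_sum_erase _ (fun i => ((A i).card : ℝ) * (b i).1) (Finset.mem_univ i),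
      Function.update_self]
    have : ∑ x ∈ Finset.univ.erase i, ((A x).card : ℝ) * (Function.update b i bi x).1 =
        ∑ x ∈ Finset.univ.erase i, ((A x).card : ℝ) * (b x).1 :=
      Finset.sum_congr rfl fun x hx => by rw [Function.update_of_ne (Finset.ne_of_mem_erase hx)]
    rw [this]
    ring
  simp only [Auction.utility, auction, payRule, Function.update_self]
  rw [h1 (allocRule r Finset.univ (Function.update b i bi))]
  ring

lemma utility_auction (r : ℕ) (i : Fin n) (b : Fin n → UserType τ) :
    (auction n τ r).utility i b (b i).1 =
      cost b (allocRule r (Finset.univ.erase i) b) - cost b (allocRule r Finset.univ b) := by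
  simp only [Auction.utility, auction, payRule]
  ring

/-- User `i` cannot raise its benchmark by misreporting: the old assignment without `i` gives `i`
nothing, so it remains a valid competitor, at unchanged cost, after the bid of `i` changes. -/
lemma cost_allocRule_erase_update_le {r : ℕ} {i : Fin n} {b : Fin n → UserType τ}
    {bi : UserType τ} (hb : ∀ i', 0 ≤ (b i').1) (hbi : 0 ≤ bi.1)
    (hserv : ∀ j, r ≤ ((Finset.univ.erase i).filter fun i' => j ∈ (b i').2).card) :
    cost (Function.update b i bi)
        (allocRule r (Finset.univ.erase i) (Function.update b i bi)) ≤
      cost b (allocRule r (Finset.univ.erase i) b) := by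
  have hi : i ∉ Finset.univ.erase i := Finset.notMem_erase i _
  refine (cost_allocRule_le (A := allocRule r (Finset.univ.erase i) b) (fun i' => ?_) (fun i' => ?_)
    (fun i' h => allocRule_eq_empty r b h) fun j => (card_servedBy_allocRule (hserv j)).ge).trans_eq
    ?_
  · by_cases h : i' = i
    · subst h
      simpa using hbi
    · simpa [h] using hb i'
  · by_cases h : i' = i
    · subst h
      simp [allocRule_eq_empty r b hi]
    · simpa [h] using allocRule_subset r _ b i'
  · refine Finset.sum_congr rfl fun i' _ => ?_
    by_cases h : i' = i
    · subst h
      simp [allocRule_eq_empty r b hi]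
    · simp [h]

/-- Bidding truthfully is a dominant strategy. -/
lemma utility_auction_update_le {r : ℕ} {i : Fin n} {b : Fin n → UserType τ} {bi : UserType τ}
    (hb : ∀ i', 0 ≤ (b i').1) (hbi : 0 ≤ bi.1) (hsub : bi.2 ⊆ (b i).2)
    (hserv : ∀ j, r ≤ ((Finset.univ.erase i).filter fun i' => j ∈ (b i').2).card) :
    (auction n τ r).utility i (Function.update b i bi) (b i).1 ≤
      (auction n τ r).utility i b (b i).1 := by
  rw [utility_auction_update, utility_auction]
  -- Since `bi.2 ⊆ (b i).2`, the assignment after the misreport is also a candidate under the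
  -- truthful bids, where the greedy one has minimal true cost.
  refine sub_le_sub (cost_allocRule_erase_update_le hb hbi hserv)
    (cost_allocRule_le hb (fun i' => ?_) (by simp) fun j => (card_servedBy_allocRule ?_).ge)
  · refine (allocRule_subset r _ _ i').trans ?_
    by_cases h : i' = i
    · subst h
      simpa using hsub
    · simp [h]
  · refine (hserv j).trans (Finset.card_le_card fun i' => ?_)
    simp only [Finset.mem_filter, Finset.mem_erase, Finset.mem_univ, and_true, true_and]
    rintro ⟨h, hj⟩
    simpa [h] using hj

lemma utility_auction_nonneg {r : ℕ} {i : Fin n} {b : Fin n → UserType τ}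
    (hb : ∀ i', 0 ≤ (b i').1)
    (hserv : ∀ j, r ≤ ((Finset.univ.erase i).filter fun i' => j ∈ (b i').2).card) :
    0 ≤ (auction n τ r).utility i b (b i).1 := by
  rw [utility_auction, sub_nonneg]
  exact cost_allocRule_le hb (fun i' => allocRule_subset r _ b i') (by simp)
    fun j => (card_servedBy_allocRule (hserv j)).ge

/-- A user whose cost is maximal has no information rent. -/
lemma utility_auction_nonpos {r : ℕ} {i : Fin n} {b : Fin n → UserType τ}
    (hb : ∀ i', 0 ≤ (b i').1) (hmax : ∀ i', (b i').1 ≤ (b i).1)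
    (hserv : ∀ j, r ≤ ((Finset.univ.erase i).filter fun i' => j ∈ (b i').2).card) :
    (auction n τ r).utility i b (b i).1 ≤ 0 := by
  have hserv' : ∀ j, r ≤ (Finset.univ.filter fun i' => j ∈ (b i').2).card := fun j =>
    (hserv j).trans (Finset.card_le_card (Finset.filter_subset_filter _ (Finset.erase_subset _ _)))
  rw [utility_auction, sub_nonpos, cost, cost, sum_card_mul, sum_card_mul]
  refine Finset.sum_le_sum fun j _ => ?_
  set C := servedBy (allocRule r Finset.univ b) j with hC
  have hCcard : C.card = r := card_servedBy_allocRule (hserv' j)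
  have hCj : ∀ i' ∈ C, j ∈ (b i').2 := fun i' h =>
    allocRule_subset r _ b i' (mem_servedBy.1 h)
  by_cases hi : i ∈ C
  -- `C.erase i` has only `r - 1` members, while at least `r` users other than `i` report `j`. The
  -- spare user `x` replaces `i` at no greater cost.
  · obtain ⟨x, hx, hxC⟩ : ∃ x ∈ (Finset.univ.erase i).filter fun i' => j ∈ (b i').2,
        x ∉ C.erase i := by
      by_contra! hcon
      have h1 := Finset.card_le_card hcon
      rw [Finset.card_erase_of_mem hi] at h1
      have h2 := Finset.card_pos.2 ⟨i, hi⟩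
      have h3 := hserv j
      omega
    simp only [Finset.mem_filter, Finset.mem_erase, Finset.mem_univ, and_true] at hx
    refine (sum_servedBy_allocRule_le (B := insert x (C.erase i)) hb (fun _ _ h => h)
      (fun i' hi' => ?_) ?_).trans ?_
    · rcases Finset.mem_insert.1 hi' with rfl | h
      · simpa using hx
      · rw [Finset.mem_erase] at h
        exact ⟨by simpa using h.1, hCj i' h.2⟩
    · rw [Finset.card_insert_of_notMem hxC, Finset.card_erase_of_mem hi]
      omega
    · rw [Finset.sum_insert hxC, ← Finset.add_sum_erase _ _ hi]
      gcongr
      exact hmax x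
  · refine sum_servedBy_allocRule_le hb (fun _ _ h => h) (fun i' hi' => ⟨?_, hCj i' hi'⟩) hCcard.ge
    simp only [Finset.mem_erase, Finset.mem_univ, and_true]
    rintro rfl
    exact hi hi'

/-! ### Bounds and measurability for CSOPT -/

lemma cost_nonneg {b : Fin n → UserType τ} (hb : ∀ i, 0 ≤ (b i).1) (A : Fin n → Finset τ) :
    0 ≤ cost b A :=
  Finset.sum_nonneg fun i _ => mul_nonneg (Nat.cast_nonneg _) (hb i)

lemma cost_le {b : Fin n → UserType τ} {C : ℝ} (hb : ∀ i, 0 ≤ (b i).1) (hC : ∀ i, (b i).1 ≤ C)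
    (A : Fin n → Finset τ) : cost b A ≤ n * (Fintype.card τ * C) := by
  refine (Finset.sum_le_card_nsmul _ _ (Fintype.card τ * C) fun i _ => ?_).trans_eq (by simp)
  exact mul_le_mul (by exact_mod_cast Finset.card_le_univ _) (hC i) (hb i) (Nat.cast_nonneg _)

/-- The assignment depends on the bids only through the pairwise cost comparisons and the reported
task sets, which range over a finite discrete space. -/
lemma measurable_allocRule (r : ℕ) (s : Finset (Fin n)) :
    Measurable fun b : Fin n → UserType τ => allocRule r s b := by
  classical
  let G : (Fin n → Fin n → Prop) × (Fin n → Finset τ) → Fin n → Finset τ := fun p =>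
    greedy p.2 ((s.sort (· ≤ ·)).insertionSort fun i i' => p.1 i i')
      (r • (Finset.univ : Finset τ).val)
  have hG : Measurable G := Measurable.of_discrete
  have h : Measurable fun b : Fin n → UserType τ =>
      ((fun i i' => (b i).1 ≤ (b i').1, fun i => (b i).2) :
        (Fin n → Fin n → Prop) × (Fin n → Finset τ)) := by
    refine Measurable.prodMk ?_ (by fun_prop)
    refine measurable_pi_lambda _ fun i => measurable_pi_lambda _ fun i' => ?_
    refine measurableSet_setOfPred.1 (measurableSet_le ?_ ?_) <;> fun_prop
  convert hG.comp h using 1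
  funext b
  simp only [G, allocRule, order, Function.comp]

lemma measurable_card {Ω : Type*} [MeasurableSpace Ω] {A : Ω → Finset τ} (hA : Measurable A) :
    Measurable fun ω => ((A ω).card : ℝ) :=
  (Measurable.of_discrete (f := fun S : Finset τ => (S.card : ℝ))).comp hA

lemma measurable_cost {A : (Fin n → UserType τ) → Fin n → Finset τ} (hA : Measurable A) :
    Measurable fun b : Fin n → UserType τ => cost b (A b) := by
  refine Finset.measurable_sum _ fun i _ => Measurable.mul ?_ (by fun_prop)
  exact measurable_card ((measurable_pi_apply i).comp hA)

lemma measurable_payRule (r : ℕ) (i : Fin n) :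
    Measurable fun b : Fin n → UserType τ => payRule r b i := by
  refine ((Measurable.mul ?_ (by fun_prop)).add (measurable_cost (measurable_allocRule r _))).sub
    (measurable_cost (measurable_allocRule r _))
  exact measurable_card ((measurable_pi_apply i).comp (measurable_allocRule r _))

lemma abs_payRule_le (r : ℕ) {b : Fin n → UserType τ} {C : ℝ} (hb : ∀ i, 0 ≤ (b i).1)
    (hC : ∀ i, (b i).1 ≤ C) (i : Fin n) :
    |payRule r b i| ≤ Fintype.card τ * C + n * (Fintype.card τ * C) := by
  have h1 := cost_nonneg hb (allocRule r (Finset.univ.erase i) b)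
  have h2 := cost_nonneg hb (allocRule r Finset.univ b)
  have h3 := cost_le hb hC (allocRule r (Finset.univ.erase i) b)
  have h4 := cost_le hb hC (allocRule r Finset.univ b)
  have h5 : ((allocRule r Finset.univ b i).card : ℝ) * (b i).1 ≤ Fintype.card τ * C :=
    mul_le_mul (by exact_mod_cast Finset.card_le_univ _) (hC i) (hb i) (Nat.cast_nonneg _)
  have h6 : 0 ≤ ((allocRule r Finset.univ b i).card : ℝ) * (b i).1 :=
    mul_nonneg (Nat.cast_nonneg _) (hb i)
  rw [payRule, abs_le]
  constructor <;> linarith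

end CSOPT

/-! ### Interim payments -/

/-- The envelope formula: a function with subgradients `-Q` is the integral of `-Q`. -/
lemma eq_add_integral_of_subgradient {a b : ℝ} {U Q : ℝ → ℝ}
    (h : ∀ c ∈ Set.Icc a b, ∀ d ∈ Set.Icc a b, U d + (d - c) * Q d ≤ U c) :
    AntitoneOn Q (Set.Icc a b) ∧
      ∀ c ∈ Set.Icc a b, U c = U b + ∫ z in c..b, Q z := by
  have hQ : AntitoneOn Q (Set.Icc a b) := by
    intro c hc d hd hcd
    rcases hcd.eq_or_lt with rfl | hlt
    · exact le_rfl
    · have h1 := h c hc d hd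
      have h2 := h d hd c hc
      by_contra! hcon
      nlinarith [mul_pos (sub_pos.2 hlt) (sub_pos.2 hcon)]
  refine ⟨hQ, fun c hc => ?_⟩
  have hint : ∀ x ∈ Set.Icc a b, ∀ y ∈ Set.Icc a b, IntervalIntegrable Q volume x y :=
    fun x hx y hy => (hQ.mono (Set.uIcc_subset_Icc hx hy)).intervalIntegrable
  -- Both `U x - U y` and the integral lie between `(y - x) * Q y` and `(y - x) * Q x`.
  have hstep : ∀ x ∈ Set.Icc a b, ∀ y ∈ Set.Icc a b, x ≤ y →
      |U x - U y - ∫ z in x..y, Q z| ≤ (y - x) * (Q x - Q y) := by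
    intro x hx y hy hxy
    have h1 := h x hx y hy
    have h2 := h y hy x hx
    have h3 : (∫ z in x..y, Q z) ≤ ∫ _ in x..y, Q x :=
      intervalIntegral.integral_mono_on hxy (hint x hx y hy) (by simp) fun z hz =>
        hQ hx ⟨hx.1.trans hz.1, hz.2.trans hy.2⟩ hz.1
    have h4 : (∫ _ in x..y, Q y) ≤ ∫ z in x..y, Q z :=
      intervalIntegral.integral_mono_on hxy (by simp) (hint x hx y hy) fun z hz =>
        hQ ⟨hx.1.trans hz.1, hz.2.trans hy.2⟩ hy hz.2
    rw [intervalIntegral.integral_const, smul_eq_mul] at h3 h4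
    rw [abs_le]
    constructor <;> linarith
  have hb : b ∈ Set.Icc a b := ⟨hc.1.trans hc.2, le_rfl⟩
  -- Cut `[c, b]` into `N + 1` equal pieces. The errors telescope to the mesh times the total drop
  -- of `Q`, which tends to zero; no differentiability of `U` is needed.
  have hN : ∀ N : ℕ, |U c - U b - ∫ z in c..b, Q z| ≤ (b - c) / (N + 1) * (Q c - Q b) := by
    intro N
    set δ := (b - c) / ((N : ℝ) + 1) with hδ
    have hδ0 : 0 ≤ δ := div_nonneg (sub_nonneg.2 hc.2) (by positivity)
    have hend : c + ((N + 1 : ℕ) : ℝ) * δ = b := by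
      rw [hδ]
      push_cast
      field_simp
      ring
    have hx : ∀ k : ℕ, k ≤ N + 1 → c + k * δ ∈ Set.Icc a b := by
      intro k hk
      have hk' : (k : ℝ) ≤ ((N + 1 : ℕ) : ℝ) := by exact_mod_cast hk
      refine ⟨le_trans hc.1 (le_add_of_nonneg_right (by positivity)), ?_⟩
      rw [← hend]
      gcongr
    have hk : ∀ k : ℕ, k ≤ N + 1 →
        |U c - U (c + k * δ) - ∫ z in c..(c + k * δ), Q z| ≤ δ * (Q c - Q (c + k * δ)) := by
      intro k
      induction k with
      | zero => simp
      | succ k ih =>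
        intro hk
        have h1 := ih (by omega)
        have hxk := hx k (by omega)
        have hxk' := hx (k + 1) hk
        have hd : c + ((k + 1 : ℕ) : ℝ) * δ - (c + k * δ) = δ := by
          push_cast
          ring
        have h2 := hstep _ hxk _ hxk' (by linarith)
        rw [hd] at h2
        have h3 := intervalIntegral.integral_add_adjacent_intervals (hint _ hc _ hxk)
          (hint _ hxk _ hxk')
        rw [← h3]
        rw [abs_le] at h1 h2 ⊢
        constructor <;> linarith
    have := hk (N + 1) le_rfl
    rwa [hend] at this
  have hlim : Filter.Tendsto (fun N : ℕ => (b - c) / ((N : ℝ) + 1) * (Q c - Q b)) Filter.atTop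
      (nhds 0) := by
    have := (tendsto_one_div_add_atTop_nhds_zero_nat (𝕜 := ℝ)).const_mul ((b - c) * (Q c - Q b))
    rw [mul_zero] at this
    refine this.congr fun N => ?_
    ring
  have := abs_nonpos_iff.1 (ge_of_tendsto' hlim hN)
  linarith

/-! ### The conditional cost law and the expected information rent -/

namespace Crowdsensing

variable {n : ℕ} {τ : Type*} [Fintype τ] [DecidableEq τ] {E : Crowdsensing n τ}
  {i : Fin n} {S : Finset τ}

lemma intervalIntegrable_f (hS : S ∈ (E.taskLaw i).support) :
    IntervalIntegrable (E.f i S.card) volume E.cLo E.cHi := by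
  -- A non-integrable function has integral `0` by convention, which contradicts total mass `1`.
  by_contra h
  have := E.f_integral i S hS
  rw [intervalIntegral.integral_undef h] at this
  exact zero_ne_one this

lemma integrableOn_f (hS : S ∈ (E.taskLaw i).support) :
    IntegrableOn (E.f i S.card) (Set.Icc E.cLo E.cHi) :=
  (intervalIntegrable_iff_integrableOn_Icc_of_le E.cLo_lt_cHi.le).1 (intervalIntegrable_f hS)

lemma isProbabilityMeasure_costLaw (hS : S ∈ (E.taskLaw i).support) :
    IsProbabilityMeasure (E.costLaw i S.card) := by
  refine ⟨?_⟩
  rw [costLaw, withDensity_apply _ MeasurableSet.univ, Measure.restrict_univ,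
    ← ofReal_integral_eq_lintegral_ofReal (integrableOn_f hS)
      (ae_restrict_of_forall_mem measurableSet_Icc (E.f_nonneg i S hS)),
    integral_Icc_eq_integral_Ioc, ← intervalIntegral.integral_of_le E.cLo_lt_cHi.le,
    E.f_integral i S hS, ENNReal.ofReal_one]

lemma costLaw_absolutelyContinuous (E : Crowdsensing n τ) (i : Fin n) (k : ℕ) :
    E.costLaw i k ≪ volume.restrict (Set.Icc E.cLo E.cHi) :=
  withDensity_absolutelyContinuous _ _

lemma ae_costLaw_mem_Ioo (E : Crowdsensing n τ) (i : Fin n) (k : ℕ) :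
    ∀ᵐ c ∂E.costLaw i k, c ∈ Set.Ioo E.cLo E.cHi := by
  refine (costLaw_absolutelyContinuous E i k).ae_le ?_
  rw [← restrict_Ioo_eq_restrict_Icc]
  exact ae_restrict_mem measurableSet_Ioo

lemma integral_costLaw (hS : S ∈ (E.taskLaw i).support) (g : ℝ → ℝ) :
    ∫ c, g c ∂E.costLaw i S.card = ∫ c in Set.Icc E.cLo E.cHi, E.f i S.card c * g c := by
  rw [costLaw, integral_withDensity_eq_integral_toReal_smul
    (E.f_measurable i S hS).ennreal_ofReal (by simp)]
  refine setIntegral_congr_fun measurableSet_Icc fun c hc => ?_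
  simp only [smul_eq_mul]
  rw [ENNReal.toReal_ofReal (E.f_nonneg i S hS c hc)]

lemma integrable_costLaw_iff (hS : S ∈ (E.taskLaw i).support) (g : ℝ → ℝ) :
    Integrable g (E.costLaw i S.card) ↔
      IntegrableOn (fun c => E.f i S.card c * g c) (Set.Icc E.cLo E.cHi) := by
  rw [costLaw, integrable_withDensity_iff_integrable_smul'
    (E.f_measurable i S hS).ennreal_ofReal (by simp)]
  refine integrableOn_congr_fun (fun c hc => ?_) measurableSet_Icc
  simp only [smul_eq_mul]
  rw [ENNReal.toReal_ofReal (E.f_nonneg i S hS c hc)]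

lemma integrable_costLaw_of_bound (hS : S ∈ (E.taskLaw i).support) {g : ℝ → ℝ}
    (hg : AEStronglyMeasurable g (volume.restrict (Set.Icc E.cLo E.cHi))) {C : ℝ}
    (hC : ∀ c ∈ Set.Icc E.cLo E.cHi, |g c| ≤ C) : Integrable g (E.costLaw i S.card) := by
  have := isProbabilityMeasure_costLaw hS
  refine Integrable.of_bound (hg.mono_ac (costLaw_absolutelyContinuous E i _)) C ?_
  filter_upwards [ae_costLaw_mem_Ioo E i S.card] with c hc
  exact hC c (Set.Ioo_subset_Icc_self hc)

lemma F_nonneg (hS : S ∈ (E.taskLaw i).support) {c : ℝ} (hc : c ∈ Set.Icc E.cLo E.cHi) :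
    0 ≤ E.F i S.card c :=
  intervalIntegral.integral_nonneg hc.1 fun z hz =>
    E.f_nonneg i S hS z ⟨hz.1, hz.2.trans hc.2⟩

lemma F_le_one (hS : S ∈ (E.taskLaw i).support) {c : ℝ} (hc : c ∈ Set.Icc E.cLo E.cHi) :
    E.F i S.card c ≤ 1 := by
  rw [← E.f_integral i S hS]
  refine intervalIntegral.integral_mono_interval le_rfl hc.1 hc.2 ?_ (intervalIntegrable_f hS)
  refine ae_restrict_of_forall_mem measurableSet_Ioc fun z hz => ?_
  exact E.f_nonneg i S hS z (Set.Ioc_subset_Icc_self hz)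

lemma continuousOn_F (hS : S ∈ (E.taskLaw i).support) :
    ContinuousOn (E.F i S.card) (Set.Icc E.cLo E.cHi) := by
  have h := intervalIntegral.continuousOn_primitive_interval (a := E.cLo) (b := E.cHi)
    (f := E.f i S.card) (μ := volume)
    (by rw [Set.uIcc_of_le E.cLo_lt_cHi.le]; exact integrableOn_f hS)
  rwa [Set.uIcc_of_le E.cLo_lt_cHi.le] at h

lemma costLaw_real_Iio (hS : S ∈ (E.taskLaw i).support) {z : ℝ}
    (hz : z ∈ Set.Icc E.cLo E.cHi) : (E.costLaw i S.card).real (Set.Iio z) = E.F i S.card z := by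
  have h := integral_costLaw hS ((Set.Iio z).indicator 1)
  rw [integral_indicator_one measurableSet_Iio] at h
  rw [h, F, intervalIntegral.integral_of_le hz.1, ← integral_Ico_eq_integral_Ioc]
  have : ∀ c, E.f i S.card c * (Set.Iio z).indicator 1 c =
      (Set.Iio z).indicator (E.f i S.card) c := fun c => by
    by_cases hc : c ∈ Set.Iio z <;> simp [hc]
  simp only [this]
  rw [setIntegral_indicator measurableSet_Iio]
  congr 2
  ext c
  simp only [Set.mem_inter_iff, Set.mem_Icc, Set.mem_Iio, Set.mem_Ico]
  exact ⟨fun h => ⟨h.1.1, h.2⟩, fun h => ⟨⟨h.1, (h.2.trans_le hz.2).le⟩, h.2⟩⟩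

/-- Fubini: `Q z` is collected by exactly the costs `c < z`, which have mass `F z`. -/
lemma integral_costLaw_integral (hS : S ∈ (E.taskLaw i).support) {Q : ℝ → ℝ}
    (hQ : IntegrableOn Q (Set.Icc E.cLo E.cHi)) :
    ∫ c, (∫ z in c..E.cHi, Q z) ∂E.costLaw i S.card =
      ∫ z in Set.Icc E.cLo E.cHi, E.F i S.card z * Q z := by
  have := isProbabilityMeasure_costLaw hS
  have h1 : ∫ c, (∫ z in c..E.cHi, Q z) ∂E.costLaw i S.card =
      ∫ c, (∫ z in Set.Icc E.cLo E.cHi, (Set.Ioi c).indicator Q z) ∂E.costLaw i S.card := by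
    refine integral_congr_ae ?_
    filter_upwards [ae_costLaw_mem_Ioo E i S.card] with c hc
    rw [intervalIntegral.integral_of_le hc.2.le, setIntegral_indicator measurableSet_Ioi]
    congr 2
    ext z
    simp only [Set.mem_inter_iff, Set.mem_Icc, Set.mem_Ioi, Set.mem_Ioc]
    exact ⟨fun h => ⟨⟨(hc.1.trans h.1).le, h.2⟩, h.1⟩, fun h => ⟨h.2, h.1.2⟩⟩
  have h2 : Integrable (Function.uncurry fun c z => (Set.Ioi c).indicator Q z)
      ((E.costLaw i S.card).prod (volume.restrict (Set.Icc E.cLo E.cHi))) := by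
    have h3 : Integrable (fun p : ℝ × ℝ => Q p.2)
        ((E.costLaw i S.card).prod (volume.restrict (Set.Icc E.cLo E.cHi))) :=
      Integrable.comp_snd hQ _
    have h4 : MeasurableSet {p : ℝ × ℝ | p.1 < p.2} := measurableSet_lt measurable_fst measurable_snd
    refine (h3.indicator h4).congr (Filter.Eventually.of_forall fun p => ?_)
    by_cases hp : p.1 < p.2 <;> simp [Function.uncurry, Set.indicator, hp]
  rw [h1, integral_integral_swap h2]
  refine setIntegral_congr_fun measurableSet_Icc fun z hz => ?_
  have h5 : ∀ c, (Set.Ioi c).indicator Q z = (Set.Iio z).indicator 1 c * Q z := fun c => by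
    by_cases hc : c < z <;> simp [hc]
  simp only [h5]
  rw [integral_mul_const, integral_indicator_one measurableSet_Iio, costLaw_real_Iio hS hz]

lemma virtualCost_nonneg (hS : S ∈ (E.taskLaw i).support) {c : ℝ}
    (hc : c ∈ Set.Icc E.cLo E.cHi) : 0 ≤ E.virtualCost i c S.card :=
  add_nonneg (E.cLo_nonneg.trans hc.1) (div_nonneg (F_nonneg hS hc) (E.f_nonneg i S hS c hc))

/-- Cancellation can fail only at the two endpoints, where the density may vanish; they form a null
set. -/
lemma f_mul_F_div_f_ae_eq (hS : S ∈ (E.taskLaw i).support) :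
    (fun c => E.f i S.card c * (E.F i S.card c / E.f i S.card c))
      =ᵐ[volume.restrict (Set.Icc E.cLo E.cHi)] E.F i S.card := by
  rw [← restrict_Ioo_eq_restrict_Icc]
  refine ae_restrict_of_forall_mem measurableSet_Ioo fun c hc => ?_
  exact mul_div_cancel₀ _ (E.f_pos i S hS c hc).ne'

/-- `F / f` may be unbounded near the endpoints, but weighted with the density it becomes the
continuous function `F`. -/
lemma integrable_virtualCost (hS : S ∈ (E.taskLaw i).support) :
    Integrable (fun c => E.virtualCost i c S.card) (E.costLaw i S.card) := by
  have hid : Integrable (fun c : ℝ => c) (E.costLaw i S.card) :=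
    integrable_costLaw_of_bound hS aestronglyMeasurable_id (C := E.cHi) fun c hc => by
      rw [abs_of_nonneg (E.cLo_nonneg.trans hc.1)]
      exact hc.2
  refine hid.add ((integrable_costLaw_iff hS _).2 ?_)
  exact (integrable_congr (f_mul_F_div_f_ae_eq hS)).2 (continuousOn_F hS).integrableOn_Icc

/-- The expected payment to a user with fixed task set under incentive compatibility, in terms of
its virtual cost and of the rent of the highest cost. -/
lemma integral_payment_of_incentive_compatible (hS : S ∈ (E.taskLaw i).support) {P Q : ℝ → ℝ}
    (h : ∀ c ∈ Set.Icc E.cLo E.cHi, ∀ d ∈ Set.Icc E.cLo E.cHi, P d - c * Q d ≤ P c - c * Q c) :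
    ∫ c, P c ∂E.costLaw i S.card =
      ∫ c, Q c * E.virtualCost i c S.card ∂E.costLaw i S.card +
        (P E.cHi - E.cHi * Q E.cHi) := by
  have := isProbabilityMeasure_costLaw hS
  obtain ⟨hanti, henv⟩ := eq_add_integral_of_subgradient (a := E.cLo) (b := E.cHi)
    (U := fun c => P c - c * Q c) (Q := Q) fun c hc d hd => by
      linarith [h c hc d hd]
  have hlo : E.cLo ∈ Set.Icc E.cLo E.cHi := ⟨le_rfl, E.cLo_lt_cHi.le⟩
  have hhi : E.cHi ∈ Set.Icc E.cLo E.cHi := ⟨E.cLo_lt_cHi.le, le_rfl⟩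
  have hQint : IntegrableOn Q (Set.Icc E.cLo E.cHi) :=
    hanti.integrableOn_isCompact isCompact_Icc
  have hQb : ∀ c ∈ Set.Icc E.cLo E.cHi, |Q c| ≤ |Q E.cLo| + |Q E.cHi| := by
    intro c hc
    have h1 := hanti hlo hc hc.1
    have h2 := hanti hc hhi hc.2
    rw [abs_le]
    constructor
    · linarith [neg_abs_le (Q E.cHi), abs_nonneg (Q E.cLo)]
    · linarith [le_abs_self (Q E.cLo), abs_nonneg (Q E.cHi)]
  have hcQ : Integrable (fun c => c * Q c) (E.costLaw i S.card) := by
    refine integrable_costLaw_of_bound hS (aestronglyMeasurable_id.mul hQint.1)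
      (C := E.cHi * (|Q E.cLo| + |Q E.cHi|)) fun c hc => ?_
    have hc0 := E.cLo_nonneg.trans hc.1
    rw [abs_mul, abs_of_nonneg hc0]
    exact mul_le_mul hc.2 (hQb c hc) (abs_nonneg _) (hc0.trans hc.2)
  have hR : Integrable (fun c => ∫ z in c..E.cHi, Q z) (E.costLaw i S.card) := by
    have hcont : ContinuousOn (fun c => ∫ z in c..E.cHi, Q z) (Set.Icc E.cLo E.cHi) := by
      have h1 := intervalIntegral.continuousOn_primitive_interval_left (a := E.cLo) (b := E.cHi)
        (f := Q) (μ := volume) (by rwa [Set.uIcc_of_le E.cLo_lt_cHi.le])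
      rwa [Set.uIcc_of_le E.cLo_lt_cHi.le] at h1
    obtain ⟨C, hC⟩ := isCompact_Icc.exists_bound_of_continuousOn hcont
    exact integrable_costLaw_of_bound hS (hcont.aestronglyMeasurable measurableSet_Icc) hC
  have hFQ : (fun c => E.f i S.card c * (Q c * (E.F i S.card c / E.f i S.card c)))
      =ᵐ[volume.restrict (Set.Icc E.cLo E.cHi)] fun c => E.F i S.card c * Q c := by
    filter_upwards [f_mul_F_div_f_ae_eq hS] with c hc
    rw [mul_left_comm, hc, mul_comm]
  have hFQint : IntegrableOn (fun c => E.F i S.card c * Q c) (Set.Icc E.cLo E.cHi) := by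
    refine Integrable.bdd_mul (c := 1) hQint
      ((continuousOn_F hS).aestronglyMeasurable measurableSet_Icc)
      (ae_restrict_of_forall_mem measurableSet_Icc fun c hc => ?_)
    rw [Real.norm_of_nonneg (F_nonneg hS hc)]
    exact F_le_one hS hc
  have hrent : Integrable (fun c => Q c * (E.F i S.card c / E.f i S.card c))
      (E.costLaw i S.card) :=
    (integrable_costLaw_iff hS _).2 ((integrable_congr hFQ).2 hFQint)
  -- The expected envelope rent is the `F / f` part of the virtual cost: both equal the Lebesgue
  -- integral of `F * Q`.
  have hrent' : ∫ c, Q c * (E.F i S.card c / E.f i S.card c) ∂E.costLaw i S.card =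
      ∫ c, (∫ z in c..E.cHi, Q z) ∂E.costLaw i S.card := by
    rw [integral_costLaw hS, integral_costLaw_integral hS hQint]
    exact integral_congr_ae hFQ
  have hP : ∫ c, P c ∂E.costLaw i S.card = ∫ c, (c * Q c + (∫ z in c..E.cHi, Q z) +
      (P E.cHi - E.cHi * Q E.cHi)) ∂E.costLaw i S.card := by
    refine integral_congr_ae ?_
    filter_upwards [ae_costLaw_mem_Ioo E i S.card] with c hc
    have := henv c (Set.Ioo_subset_Icc_self hc)
    linarith
  have hH : ∀ c, Q c * E.virtualCost i c S.card =
      c * Q c + Q c * (E.F i S.card c / E.f i S.card c) := fun c => by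
    rw [virtualCost]
    ring
  rw [hP, integral_add (f := fun c => c * Q c + ∫ z in c..E.cHi, Q z) (hcQ.add hR)
    (integrable_const _), integral_add hcQ hR, ← hrent']
  simp only [hH]
  rw [integral_add hcQ hrent]
  simp

end Crowdsensing

namespace Crowdsensing

variable {n : ℕ} {τ : Type*} [Fintype τ] [DecidableEq τ] {E : Crowdsensing n τ}

/-! ### The law of the types -/

/-- Task sets outside the support have weight zero, so they are harmless although nothing is assumed
about their densities. -/
lemma ae_userLaw {i : Fin n} {p : UserType τ → Prop}
    (h : ∀ S ∈ (E.taskLaw i).support, ∀ᵐ c ∂E.costLaw i S.card, p (c, S)) :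
    ∀ᵐ θ ∂E.userLaw i, p θ := by
  rw [userLaw, ae_finsetSum_measure_iff]
  intro S _
  by_cases hS : S ∈ (E.taskLaw i).support
  · exact Measure.ae_smul_measure (((measurableEmbedding_prod_mk_right S).ae_map_iff).2 (h S hS)) _
  · rw [PMF.apply_eq_zero_iff _ _ |>.2 hS, zero_smul]
    simp

lemma integrable_userLaw_iff {i : Fin n} {g : UserType τ → ℝ} :
    Integrable g (E.userLaw i) ↔
      ∀ S ∈ (E.taskLaw i).support, Integrable (fun c => g (c, S)) (E.costLaw i S.card) := by
  rw [userLaw, integrable_finsetSum_measure]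
  refine ⟨fun h S hS => ?_, fun h S _ => ?_⟩
  · have := (integrable_smul_measure ((PMF.mem_support_iff _ _).1 hS)
      (PMF.apply_ne_top _ _)).1 (h S (Finset.mem_univ S))
    exact (measurableEmbedding_prod_mk_right S).integrable_map_iff.1 this
  · by_cases hS : S ∈ (E.taskLaw i).support
    · exact ((measurableEmbedding_prod_mk_right S).integrable_map_iff.2 (h S hS)).smul_measure
        (PMF.apply_ne_top _ _)
    · rw [PMF.apply_eq_zero_iff _ _ |>.2 hS, zero_smul]
      exact integrable_zero_measure

lemma integral_userLaw {i : Fin n} {g : UserType τ → ℝ} (hg : Integrable g (E.userLaw i)) :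
    ∫ θ, g θ ∂E.userLaw i =
      ∑ S, (E.taskLaw i S).toReal * ∫ c, g (c, S) ∂E.costLaw i S.card := by
  have h := hg
  rw [userLaw, integrable_finsetSum_measure] at h
  rw [userLaw, integral_finsetSum_measure h]
  refine Finset.sum_congr rfl fun S _ => ?_
  rw [integral_smul_measure, (measurableEmbedding_prod_mk_right S).integral_map, smul_eq_mul]

instance isProbabilityMeasure_userLaw (E : Crowdsensing n τ) (i : Fin n) :
    IsProbabilityMeasure (E.userLaw i) := by
  refine ⟨?_⟩
  rw [userLaw, Measure.finsetSum_apply, ← (E.taskLaw i).tsum_coe, tsum_fintype]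
  refine Finset.sum_congr rfl fun S _ => ?_
  by_cases hS : S ∈ (E.taskLaw i).support
  · have := isProbabilityMeasure_costLaw hS
    rw [Measure.smul_apply, (measurableEmbedding_prod_mk_right S).map_apply, Set.preimage_univ,
      measure_univ, smul_eq_mul, mul_one]
  · rw [PMF.apply_eq_zero_iff _ _ |>.2 hS, zero_smul]
    simp

instance isProbabilityMeasure_typeLaw (E : Crowdsensing n τ) : IsProbabilityMeasure E.typeLaw :=
  inferInstanceAs (IsProbabilityMeasure (Measure.pi E.userLaw))

lemma ae_typeLaw (E : Crowdsensing n τ) :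
    ∀ᵐ θ ∂E.typeLaw, ∀ i, (θ i).1 ∈ Set.Ioo E.cLo E.cHi ∧ (θ i).2 ∈ (E.taskLaw i).support := by
  rw [ae_all_iff]
  intro i
  refine (measurePreserving_eval E.userLaw i).quasiMeasurePreserving.ae
    (p := fun x => x.1 ∈ Set.Ioo E.cLo E.cHi ∧ x.2 ∈ (E.taskLaw i).support) ?_
  refine ae_userLaw fun S hS => ?_
  filter_upwards [ae_costLaw_mem_Ioo E i S.card] with c hc
  exact ⟨hc, hS⟩

/-- Redrawing the type of one user does not change the law of the type profile. -/
lemma measurePreserving_update (E : Crowdsensing n τ) (i : Fin n) :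
    MeasurePreserving (fun p : UserType τ × (Fin n → UserType τ) => Function.update p.2 i p.1)
      ((E.userLaw i).prod E.typeLaw) E.typeLaw := by
  have hmeas : Measurable
      fun p : UserType τ × (Fin n → UserType τ) => Function.update p.2 i p.1 := by
    refine measurable_pi_lambda _ fun j => ?_
    by_cases h : j = i
    · subst h
      simpa using measurable_fst
    · simp only [Function.update_of_ne h]
      fun_prop
  refine ⟨hmeas, (Measure.pi_eq fun s hs => ?_).symm⟩
  rw [Measure.map_apply hmeas (MeasurableSet.univ_pi hs)]
  -- The old coordinate `i` is overwritten, so its side of the box becomes `Set.univ`, of mass one.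
  have : (fun p : UserType τ × (Fin n → UserType τ) => Function.update p.2 i p.1) ⁻¹'
      Set.univ.pi s = s i ×ˢ Set.univ.pi (Function.update s i Set.univ) := by
    ext p
    simp only [Set.mem_preimage, Set.mem_pi, Set.mem_univ, true_implies, Set.mem_prod]
    constructor
    · intro h
      refine ⟨by simpa using h i, fun j => ?_⟩
      by_cases hj : j = i
      · subst hj
        simp
      · simpa [hj] using h j
    · rintro ⟨h1, h2⟩ j
      by_cases hj : j = i
      · subst hj
        simpa using h1
      · simpa [hj] using h2 j
  rw [this, Measure.prod_prod, typeLaw, Measure.pi_pi,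
    ← Finset.mul_prod_erase _ _ (Finset.mem_univ i),
    ← Finset.mul_prod_erase _ (fun j => E.userLaw j (s j)) (Finset.mem_univ i),
    Function.update_self, measure_univ, one_mul]
  congr 1
  exact Finset.prod_congr rfl fun j hj => by rw [Function.update_of_ne (Finset.ne_of_mem_erase hj)]

lemma measurable_update_right (i : Fin n) (bi : UserType τ) :
    Measurable fun θ : Fin n → UserType τ => Function.update θ i bi := by
  refine measurable_pi_lambda _ fun j => ?_
  by_cases h : j = i
  · subst h
    simp
  · simp only [Function.update_of_ne h]
    fun_prop

lemma integrable_integral_update {i : Fin n} {g : (Fin n → UserType τ) → ℝ}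
    (hg : Integrable g E.typeLaw) :
    Integrable (fun bi => ∫ θ, g (Function.update θ i bi) ∂E.typeLaw) (E.userLaw i) :=
  ((measurePreserving_update E i).integrable_comp_of_integrable hg).integral_prod_left

lemma integral_integral_update {i : Fin n} {g : (Fin n → UserType τ) → ℝ}
    (hg : Integrable g E.typeLaw) :
    ∫ bi, (∫ θ, g (Function.update θ i bi) ∂E.typeLaw) ∂E.userLaw i = ∫ θ, g θ ∂E.typeLaw := by
  have hmp := measurePreserving_update E i
  have h := integral_map hmp.measurable.aemeasurable (f := g) (by rw [hmp.map_eq]; exact hg.1)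
  rw [hmp.map_eq] at h
  rw [h]
  exact (integral_prod _ (hmp.integrable_comp_of_integrable hg)).symm

/-! ### The revenue formula -/

section Auction

variable {M : Auction n τ}

lemma integrable_card_alloc (hM : E.HasExpectations M) (i : Fin n)
    {φ : (Fin n → UserType τ) → Fin n → UserType τ} (hφ : Measurable φ) :
    Integrable (fun θ => ((M.alloc (φ θ) i).card : ℝ)) E.typeLaw := by
  refine Integrable.of_bound
    (CSOPT.measurable_card ((hM i).1.comp hφ)).aestronglyMeasurable (Fintype.card τ)
    (Filter.Eventually.of_forall fun θ => ?_)
  rw [Real.norm_of_nonneg (Nat.cast_nonneg _)]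
  exact_mod_cast Finset.card_le_univ _

lemma self_mem_bids {i : Fin n} {θ : UserType τ} (hθ : θ ∈ E.types i) : θ ∈ E.bids θ :=
  ⟨hθ.1, subset_rfl⟩

lemma interimUtility_eq (hM : E.HasExpectations M) {i : Fin n} {bi : UserType τ}
    (hbi : bi ∈ E.types i) (c : ℝ) :
    E.interimUtility M i bi c = ∫ θ, M.pay (Function.update θ i bi) i ∂E.typeLaw -
      c * ∫ θ, ((M.alloc (Function.update θ i bi) i).card : ℝ) ∂E.typeLaw := by
  simp only [interimUtility, Auction.utility]
  rw [integral_sub ((hM i).2.2.2 bi hbi bi (self_mem_bids hbi))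
    ((integrable_card_alloc hM i (measurable_update_right i bi)).mul_const _),
    integral_mul_const, mul_comm c]

lemma integrable_virtualCost_userLaw (E : Crowdsensing n τ) (i : Fin n) :
    Integrable (fun θ : UserType τ => E.virtualCost i θ.1 θ.2.card) (E.userLaw i) :=
  integrable_userLaw_iff.2 fun _ hS => integrable_virtualCost hS

lemma integrable_card_mul_virtualCost (hM : E.HasExpectations M) (i : Fin n) :
    Integrable (fun θ => ((M.alloc θ i).card : ℝ) * E.virtualCost i (θ i).1 (θ i).2.card)
      E.typeLaw := by
  have h : Integrable (fun θ : Fin n → UserType τ => E.virtualCost i (θ i).1 (θ i).2.card)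
      E.typeLaw :=
    (measurePreserving_eval E.userLaw i).integrable_comp_of_integrable
      (integrable_virtualCost_userLaw E i)
  refine h.bdd_mul (c := Fintype.card τ)
    (CSOPT.measurable_card (hM i).1).aestronglyMeasurable (Filter.Eventually.of_forall fun θ => ?_)
  rw [Real.norm_of_nonneg (Nat.cast_nonneg _)]
  exact_mod_cast Finset.card_le_univ _

/-- Conditioning on the user's own type reduces this to one cost variable for each task set. Only
misreports of the cost, with the task set reported truthfully, are exploited. -/
lemma integral_pay (hM : E.HasExpectations M) (hBIC : E.BIC M) (i : Fin n) :
    ∫ θ, M.pay θ i ∂E.typeLaw =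
      ∫ θ, ((M.alloc θ i).card : ℝ) * E.virtualCost i (θ i).1 (θ i).2.card ∂E.typeLaw +
        ∑ S, (E.taskLaw i S).toReal * E.interimUtility M i (E.cHi, S) E.cHi := by
  have hpay := (hM i).2.2.1
  have hvc := integrable_card_mul_virtualCost hM i
  rw [← integral_integral_update (i := i) hpay, ← integral_integral_update (i := i) hvc,
    integral_userLaw (integrable_integral_update hpay),
    integral_userLaw (integrable_integral_update hvc), ← Finset.sum_add_distrib]
  refine Finset.sum_congr rfl fun S _ => ?_
  rw [← mul_add]
  by_cases hS : S ∈ (E.taskLaw i).support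
  · congr 1
    have hmem : ∀ c ∈ Set.Icc E.cLo E.cHi, ((c, S) : UserType τ) ∈ E.types i :=
      fun c hc => ⟨hc, hS⟩
    rw [interimUtility_eq hM (hmem E.cHi ⟨E.cLo_lt_cHi.le, le_rfl⟩)]
    simp only [Function.update_self, integral_mul_const]
    refine integral_payment_of_incentive_compatible hS
      (P := fun c => ∫ θ, M.pay (Function.update θ i (c, S)) i ∂E.typeLaw)
      (Q := fun c => ∫ θ, ((M.alloc (Function.update θ i (c, S)) i).card : ℝ) ∂E.typeLaw)
      fun c hc d hd => ?_
    have := hBIC i (c, S) (hmem c hc) (d, S) ⟨hd, subset_rfl⟩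
    rwa [interimUtility_eq hM (hmem d hd), interimUtility_eq hM (hmem c hc)] at this
  · rw [PMF.apply_eq_zero_iff _ _ |>.2 hS]
    simp

end Auction

end Crowdsensing

namespace Crowdsensing

variable {n : ℕ} {τ : Type*} [Fintype τ] [DecidableEq τ] {E : Crowdsensing n τ}

/-! ### CSOPT is admissible -/

lemma requirement_le_iff (E : Crowdsensing n τ) (m : ℕ) :
    E.requirement ≤ (m : ℝ) ↔ E.repeatFactor ≤ m :=
  Nat.ceil_le.symm

lemma Servable.repeatFactor_le {s : Finset (Fin n)} {T : Fin n → Finset τ} (h : E.Servable s T)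
    (j : τ) : E.repeatFactor ≤ (s.filter fun i => j ∈ T i).card :=
  (requirement_le_iff E _).1 (h j)

lemma Servable.mono {s t : Finset (Fin n)} {T : Fin n → Finset τ} (h : E.Servable s T)
    (hst : s ⊆ t) : E.Servable t T := fun j =>
  (h j).trans (by exact_mod_cast Finset.card_le_card (Finset.filter_subset_filter _ hst))

lemma update_mem_types {i : Fin n} {bi : UserType τ} (hbi : bi ∈ E.types i)
    {θ : Fin n → UserType τ} (hθ : ∀ i, θ i ∈ E.types i) (i' : Fin n) :
    Function.update θ i bi i' ∈ E.types i' := by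
  by_cases h : i' = i
  · subst h
    simpa using hbi
  · simpa [h] using hθ i'

lemma ae_typeLaw_mem_types (E : Crowdsensing n τ) : ∀ᵐ θ ∂E.typeLaw, ∀ i, θ i ∈ E.types i := by
  filter_upwards [ae_typeLaw E] with θ hθ i
  exact ⟨Set.Ioo_subset_Icc_self (hθ i).1, (hθ i).2⟩

lemma hasExpectations_CSOPT (E : Crowdsensing n τ) (r : ℕ) :
    E.HasExpectations (CSOPT.auction n τ r) := by
  refine fun i => ⟨(measurable_pi_apply i).comp (CSOPT.measurable_allocRule r _),
    CSOPT.measurable_payRule r i, ?_, fun θ hθ bi hbi => ?_⟩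
  · refine Integrable.of_bound (CSOPT.measurable_payRule r i).aestronglyMeasurable
      (Fintype.card τ * E.cHi + n * (Fintype.card τ * E.cHi)) ?_
    filter_upwards [ae_typeLaw_mem_types E] with θ hθ
    exact CSOPT.abs_payRule_le r (fun i => E.cLo_nonneg.trans (hθ i).1.1) (fun i => (hθ i).1.2) i
  · refine Integrable.of_bound ((CSOPT.measurable_payRule r i).comp
      (measurable_update_right i bi)).aestronglyMeasurable
      (Fintype.card τ * E.cHi + n * (Fintype.card τ * E.cHi)) ?_
    filter_upwards [ae_typeLaw_mem_types E] with θ' hθ'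
    have hmem : ∀ i', (Function.update θ' i bi i').1 ∈ Set.Icc E.cLo E.cHi := by
      intro i'
      by_cases h : i' = i
      · subst h
        simpa using hbi.1
      · simpa [h] using (hθ' i').1
    exact CSOPT.abs_payRule_le r (fun i => E.cLo_nonneg.trans (hmem i).1) (fun i => (hmem i).2) i

lemma integrable_utility_update {M : Auction n τ} (hM : E.HasExpectations M) {i : Fin n}
    {θ bi : UserType τ} (hθ : θ ∈ E.types i) (hbi : bi ∈ E.bids θ) (c : ℝ) :
    Integrable (fun θ' => M.utility i (Function.update θ' i bi) c) E.typeLaw :=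
  ((hM i).2.2.2 θ hθ bi hbi).sub
    ((integrable_card_alloc hM i (measurable_update_right i bi)).mul_const c)

lemma Competition.repeatFactor_le (h : E.Competition) {i : Fin n} {θ : Fin n → UserType τ}
    (hθ : ∀ i', θ i' ∈ E.types i') (j : τ) :
    E.repeatFactor ≤ ((Finset.univ.erase i).filter fun i' => j ∈ (θ i').2).card :=
  (h (fun i' => (θ i').2) (fun i' => (hθ i').2) i).repeatFactor_le j

/-- Truthfulness is dominant at almost every profile of the others, and the inequality survives
integration. -/
lemma BIC_CSOPT (h : E.Competition) : E.BIC (CSOPT.auction n τ E.repeatFactor) := by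
  intro i θ hθ bi hbi
  have hM := hasExpectations_CSOPT E E.repeatFactor
  refine integral_mono_ae (integrable_utility_update hM hθ hbi _)
    (integrable_utility_update hM hθ (self_mem_bids hθ) _) ?_
  filter_upwards [ae_typeLaw_mem_types E] with θ' hθ'
  have hmem := update_mem_types hθ hθ'
  have := CSOPT.utility_auction_update_le (i := i) (b := Function.update θ' i θ) (bi := bi)
    (fun i' => E.cLo_nonneg.trans (hmem i').1.1) (E.cLo_nonneg.trans hbi.1.1)
    (by simpa using hbi.2) (h.repeatFactor_le hmem)
  simpa using this

lemma IR_CSOPT (h : E.Competition) : E.IR (CSOPT.auction n τ E.repeatFactor) := by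
  intro i θ hθ
  refine integral_nonneg_of_ae ?_
  filter_upwards [ae_typeLaw_mem_types E] with θ' hθ'
  have hmem := update_mem_types hθ hθ'
  have := CSOPT.utility_auction_nonneg (i := i) (b := Function.update θ' i θ)
    (fun i' => E.cLo_nonneg.trans (hmem i').1.1) (h.repeatFactor_le hmem)
  simpa using this

/-- A user with cost `cHi` has maximal cost at almost every profile, hence no rent there. -/
lemma interimUtility_CSOPT_cHi (h : E.Competition) {i : Fin n} {S : Finset τ}
    (hS : S ∈ (E.taskLaw i).support) :
    E.interimUtility (CSOPT.auction n τ E.repeatFactor) i (E.cHi, S) E.cHi = 0 := by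
  have hθ : ((E.cHi, S) : UserType τ) ∈ E.types i := ⟨⟨E.cLo_lt_cHi.le, le_rfl⟩, hS⟩
  refine le_antisymm ?_ (IR_CSOPT h i _ hθ)
  refine integral_nonpos_of_ae ?_
  filter_upwards [ae_typeLaw_mem_types E] with θ' hθ'
  have hmem := update_mem_types hθ hθ'
  have := CSOPT.utility_auction_nonpos (i := i) (b := Function.update θ' i (E.cHi, S))
    (fun i' => E.cLo_nonneg.trans (hmem i').1.1) (fun i' => by simpa using (hmem i').1.2)
    (h.repeatFactor_le hmem)
  simpa using this

lemma feasible_CSOPT (E : Crowdsensing n τ) :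
    E.Feasible (CSOPT.auction n τ E.repeatFactor) := by
  refine fun b _ hserv => ⟨fun j => ?_, CSOPT.allocRule_subset _ _ b⟩
  rw [requirement_le_iff]
  exact (CSOPT.card_servedBy_allocRule (hserv.repeatFactor_le j)).ge

lemma admissible_CSOPT (h : E.Competition) :
    E.Admissible (CSOPT.auction n τ E.repeatFactor) :=
  ⟨hasExpectations_CSOPT E _, BIC_CSOPT h, IR_CSOPT h, feasible_CSOPT E⟩

lemma exPostIR_CSOPT (E : Crowdsensing n τ) :
    E.ExPostIR (CSOPT.auction n τ E.repeatFactor) := fun _ _ hb hserv =>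
  CSOPT.utility_auction_nonneg (fun i' => E.cLo_nonneg.trans (hb i').1) hserv.repeatFactor_le

/-! ### Optimality of CSOPT -/

/-- The expected total virtual cost of the assignment. -/
noncomputable def expectedVirtualCost (E : Crowdsensing n τ) (M : Auction n τ) : ℝ :=
  ∫ θ, ∑ i, ((M.alloc θ i).card : ℝ) * E.virtualCost i (θ i).1 (θ i).2.card ∂E.typeLaw

lemma expectedPayment_eq {M : Auction n τ} (hM : E.HasExpectations M) (hBIC : E.BIC M) :
    E.expectedPayment M = E.expectedVirtualCost M +
      ∑ i, ∑ S, (E.taskLaw i S).toReal * E.interimUtility M i (E.cHi, S) E.cHi := by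
  rw [expectedPayment, expectedVirtualCost,
    integral_finsetSum _ fun i _ => (hM i).2.2.1,
    integral_finsetSum _ fun i _ => integrable_card_mul_virtualCost hM i,
    ← Finset.sum_add_distrib]
  exact Finset.sum_congr rfl fun i _ => integral_pay hM hBIC i

/-- All users share one virtual cost function, which makes virtual costs of different users
comparable through their costs alone. -/
lemma IdenticalCosts.virtualCost_eq (h : E.IdenticalCosts) {i i' : Fin n} {S S' : Finset τ}
    (hS : S ∈ (E.taskLaw i).support) (hS' : S' ∈ (E.taskLaw i').support) {c : ℝ}
    (hc : c ∈ Set.Icc E.cLo E.cHi) :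
    E.virtualCost i c S.card = E.virtualCost i' c S'.card := by
  have hF : E.F i S.card c = E.F i' S'.card c := by
    refine intervalIntegral.integral_congr fun z hz => ?_
    rw [Set.uIcc_of_le hc.1] at hz
    exact h i i' S hS S' hS' z ⟨hz.1, hz.2.trans hc.2⟩
  rw [virtualCost, virtualCost, hF, h i i' S hS S' hS' c hc]

/-- The comparison holds at almost every type profile: virtual cost is a nonnegative weight,
monotone in cost, and any feasible assignment competes with the greedy one. -/
lemma expectedVirtualCost_CSOPT_le (hregular : E.Regular) (hcosts : E.IdenticalCosts)
    (hcompetition : E.Competition) {M : Auction n τ} (hM : E.HasExpectations M)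
    (hfeas : E.Feasible M) :
    E.expectedVirtualCost (CSOPT.auction n τ E.repeatFactor) ≤ E.expectedVirtualCost M := by
  refine integral_mono_ae
    (integrable_finsetSum _ fun i _ =>
      integrable_card_mul_virtualCost (hasExpectations_CSOPT E _) i)
    (integrable_finsetSum _ fun i _ => integrable_card_mul_virtualCost hM i) ?_
  filter_upwards [ae_typeLaw E] with θ hθ
  have hθ' : ∀ i, θ i ∈ E.types i := fun i => ⟨Set.Ioo_subset_Icc_self (hθ i).1, (hθ i).2⟩
  -- Competition yields servability only by leaving out some user; with no users both sums are
  -- empty.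
  rcases isEmpty_or_nonempty (Fin n) with _ | ⟨⟨i₀⟩⟩
  · simp
  have hserv : E.Servable Finset.univ fun i => (θ i).2 :=
    (hcompetition (fun i => (θ i).2) (fun i => (hθ i).2) i₀).mono (Finset.erase_subset _ _)
  obtain ⟨hcov, hsub⟩ := hfeas θ (fun i => (hθ' i).1) hserv
  refine CSOPT.sum_allocRule_le (fun i => virtualCost_nonneg (hθ i).2 (hθ' i).1)
    (fun i i' hle => ?_) hsub (by simp) fun j => (requirement_le_iff E _).1 (hcov j)
  rw [← hcosts.virtualCost_eq (hθ i).2 (hθ i').2 (hθ' i').1]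
  exact (hregular i).1 _ (hθ i).2 (hθ i).1 (hθ i').1 hle

lemma expectedPayment_CSOPT_le (hregular : E.Regular) (hcosts : E.IdenticalCosts)
    (hcompetition : E.Competition) {M : Auction n τ} (hM : E.Admissible M) :
    E.expectedPayment (CSOPT.auction n τ E.repeatFactor) ≤ E.expectedPayment M := by
  obtain ⟨hexp, hBIC, hIR, hfeas⟩ := hM
  rw [expectedPayment_eq (hasExpectations_CSOPT E _) (BIC_CSOPT hcompetition),
    expectedPayment_eq hexp hBIC]
  -- The rents at `cHi` vanish for CSOPT and are nonnegative for `M` by IR.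
  refine add_le_add (expectedVirtualCost_CSOPT_le hregular hcosts hcompetition hexp hfeas)
    (Finset.sum_le_sum fun i _ => Finset.sum_le_sum fun S _ => ?_)
  by_cases hS : S ∈ (E.taskLaw i).support
  · rw [interimUtility_CSOPT_cHi hcompetition hS, mul_zero]
    exact mul_nonneg ENNReal.toReal_nonneg
      (hIR i (E.cHi, S) ⟨⟨E.cLo_lt_cHi.le, le_rfl⟩, hS⟩)
  · rw [PMF.apply_eq_zero_iff _ _ |>.2 hS]
    simp

end Crowdsensing

theorem theorem3 {n : ℕ} {τ : Type*} [Fintype τ] [DecidableEq τ] (E : Crowdsensing n τ)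
    (hregular : E.Regular) (hcosts : E.IdenticalCosts) (hcompetition : E.Competition) :
    E.IsOptimalAuction (CSOPT.auction n τ E.repeatFactor) ∧
      E.ExPostIR (CSOPT.auction n τ E.repeatFactor) :=
  ⟨⟨Crowdsensing.admissible_CSOPT hcompetition, fun _ =>
    Crowdsensing.expectedPayment_CSOPT_le hregular hcosts hcompetition⟩,
    Crowdsensing.exPostIR_CSOPT E⟩
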